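/- Let $\zeta$ denote the Riemann zeta function and let $\alpha \in (1/2,1)$ be fixed. Then there is a $T_0 = T_0(\alpha)$ such that for all real $T \geq T_0$ $$ \max_{0 \leq t \leq T} |\zeta(\alpha+it)| \geq \exp\left(\frac{c_\alpha (\log T)^{1-\alpha}}{(\log\log T)^{\alpha}}\right), \qquad \text{where } c_\alpha = 0.18\,(2\alpha-1)^{1-\alpha}. $$ -/

import Mathlib

open Filter Topology

/-! The proof is a resonance argument in which positivity replaces the evaluation of off-diagonal
terms. Let `M` bound `|ζ(α+it)|` for `|t| ≤ T`. Weight the line by `w(t) = (T - |t|) |R(t)|²`, where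
`R(t) = ∏ (1 - p^{it}/2)⁻¹` over a set `S` of primes, and put `F(u) = Re ∫ e^{iut} w(t) dt` over
`[-T, T]`. The triangular kernel has a nonnegative transform (Fejér), and multiplication by each
geometric series keeps it nonnegative, so `F ≥ 0` everywhere. The same recursion gives `F(-log n) ≥
2^{-k} F(0)` when `n` is a product of `k` distinct primes of `S`.

On the segment, `ζ(s)` is the partial sum up to `N` plus a pole term `N^{1-s}/(s-1)` and an error
`O(|s| N^{-α})`. Integrating the real part of the partial sum against `w` gives `∑ n^{-α} F(-log
n)`; by positivity all `n` other than the products of distinct primes can be dropped. Hence `M` is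
at least `∑ 2^{-k} n^{-α}` over such products `n ≤ N`, up to bounded errors (`resonance_inequality`,
`one_add_pow_le_of_norm_zeta_le`). If all primes are at most `P`, Rankin's trick shows that this sum
is essentially at least `(1 + P^{-α}/2)^{|S|}`.

With `L = log T` and `c = 2α - 1`, take `N ≈ T^{1/α}`, `|S| = ⌊cL/2⌋` and `P = c L log L`. The main
term is then about `exp(cL P^{-α}/4)`, and `cL P^{-α} = c^{1-α} L^{1-α}/(log L)^α`. The constant
`0.18 < 1/4` absorbs all losses. -/

/-! ### Approximation of `ζ` by partial sums for `Re s > 0`. -/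

/-- The difference `(s - 1) * (∫ x in n..n+1, x⁻ˢ - (n + 1)⁻ˢ)` in closed form. -/
noncomputable def zetaStep (n : ℕ) (s : ℂ) : ℂ :=
  (n : ℂ) ^ (1 - s) - ((n + 1 : ℕ) : ℂ) ^ (1 - s) - (s - 1) * ((n + 1 : ℕ) : ℂ) ^ (-s)

/-- Replacing `n + 1` by a variable `x` gives a function vanishing at `x = n` with derivative `(s-1)
s (x-n) x^{-s-1}`; integrating the norm of this derivative gives a bound that telescopes in `n`. A
`δ` below `Re s` is allowed so that the bound is uniform on bounded regions. -/
theorem norm_zetaStep_le {n : ℕ} (hn : 1 ≤ n) {s : ℂ} {δ : ℝ} (hδ : 0 < δ) (hs : δ ≤ s.re) :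
    ‖zetaStep n s‖ ≤ ‖s - 1‖ * ‖s‖ / δ * ((n : ℝ) ^ (-δ) - ((n + 1 : ℕ) : ℝ) ^ (-δ)) := by
  have hn' : (1 : ℝ) ≤ n := by exact_mod_cast hn
  set f : ℝ → ℂ := fun x =>
    (n : ℂ) ^ (1 - s) - (x : ℂ) ^ (1 - s) - (s - 1) * ((x - n) * (x : ℂ) ^ (-s)) with hf
  set f' : ℝ → ℂ := fun x => (s - 1) * s * (x - n) * (x : ℂ) ^ (-s - 1) with hf'
  set B : ℝ → ℝ := fun x => ‖s - 1‖ * ‖s‖ / δ * ((n : ℝ) ^ (-δ) - x ^ (-δ)) with hB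
  set B' : ℝ → ℝ := fun x => ‖s - 1‖ * ‖s‖ * x ^ (-δ - 1) with hB'
  have hder : ∀ x : ℝ, 1 ≤ x → HasDerivAt f (f' x) x := by
    intro x hx
    have hx0 : (x : ℂ) ∈ Complex.slitPlane := Complex.ofReal_mem_slitPlane.2 (by linarith)
    have hxne : (x : ℂ) ≠ 0 := Complex.slitPlane_ne_zero hx0
    have h1 : HasDerivAt (fun y : ℂ => y ^ (1 - s)) _ (x : ℂ) :=
      (hasDerivAt_id (x : ℂ)).cpow_const hx0
    have h2 : HasDerivAt (fun y : ℂ => y ^ (-s)) _ (x : ℂ) :=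
      (hasDerivAt_id (x : ℂ)).cpow_const hx0
    have h3 := (((h1.const_sub ((n : ℂ) ^ (1 - s))).sub
      ((((hasDerivAt_id (x : ℂ)).sub_const (n : ℂ)).mul h2).const_mul (s - 1)))).comp_ofReal
    refine h3.congr_deriv ?_
    simp only [hf', id]
    have e1 : (x : ℂ) ^ (1 - s - 1) = x * (x : ℂ) ^ (-s - 1) := by
      nth_rewrite 2 [← Complex.cpow_one (x : ℂ)]
      rw [← Complex.cpow_add _ _ hxne]; congr 1; ring
    have e2 : (x : ℂ) ^ (-s) = x * (x : ℂ) ^ (-s - 1) := by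
      nth_rewrite 2 [← Complex.cpow_one (x : ℂ)]
      rw [← Complex.cpow_add _ _ hxne]; congr 1; ring
    rw [e1, e2]; ring
  have hderB : ∀ x : ℝ, 1 ≤ x → HasDerivAt B (B' x) x := by
    intro x hx
    have h1 := (((Real.hasDerivAt_rpow_const (p := -δ) (Or.inl (by linarith : x ≠ 0))).const_sub
      ((n : ℝ) ^ (-δ))).const_mul (‖s - 1‖ * ‖s‖ / δ))
    refine h1.congr_deriv ?_
    simp only [hB']; field_simp
  have key := image_norm_le_of_norm_deriv_right_le_deriv_boundary' (f := f) (f' := f') (B := B)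
    (B' := B') (a := n) (b := n + 1)
    (fun x hx => (hder x (hn'.trans hx.1)).continuousAt.continuousWithinAt)
    (fun x hx => (hder x (hn'.trans hx.1)).hasDerivWithinAt)
    (by simp [hf, hB])
    (fun x hx => (hderB x (hn'.trans hx.1)).continuousAt.continuousWithinAt)
    (fun x hx => (hderB x (hn'.trans hx.1)).hasDerivWithinAt) ?_
    (x := n + 1) ⟨by linarith, le_rfl⟩
  · simpa [hf, hB, zetaStep] using key
  · intro x hx
    have hx1 : 1 ≤ x := hn'.trans hx.1
    have hx0 : 0 < x := by linarith
    simp only [hf', hB', norm_mul]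
    rw [Complex.norm_cpow_eq_rpow_re_of_pos hx0]
    have hxn : ‖(x : ℂ) - n‖ ≤ 1 := by
      have : (x : ℂ) - n = ((x - n : ℝ) : ℂ) := by push_cast; rfl
      rw [this, Complex.norm_real, Real.norm_eq_abs, abs_le]
      constructor <;> linarith [hx.1, hx.2]
    have hp : x ^ (-s - 1).re ≤ x ^ (-δ - 1) :=
      Real.rpow_le_rpow_of_exponent_le hx1 (by simp; linarith)
    calc ‖s - 1‖ * ‖s‖ * ‖(x : ℂ) - n‖ * x ^ (-s - 1).re
        ≤ ‖s - 1‖ * ‖s‖ * 1 * x ^ (-δ - 1) := by gcongr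
      _ = _ := by ring

theorem hasSum_rpow_neg_sub {N : ℕ} (hN : 1 ≤ N) {δ : ℝ} (hδ : 0 < δ) :
    HasSum (fun k : ℕ => ((N + k : ℕ) : ℝ) ^ (-δ) - ((N + k + 1 : ℕ) : ℝ) ^ (-δ))
      ((N : ℝ) ^ (-δ)) := by
  have hpos : ∀ k : ℕ, (0 : ℝ) < ((N + k : ℕ) : ℝ) := fun k => by exact_mod_cast (by omega)
  rw [hasSum_iff_tendsto_nat_of_nonneg]
  · have h : ∀ m : ℕ, ∑ k ∈ Finset.range m,
        (((N + k : ℕ) : ℝ) ^ (-δ) - ((N + k + 1 : ℕ) : ℝ) ^ (-δ))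
          = (N : ℝ) ^ (-δ) - ((N + m : ℕ) : ℝ) ^ (-δ) := by
      intro m
      induction m with
      | zero => simp
      | succ m ih => rw [Finset.sum_range_succ, ih]; ring_nf
    simp only [h]
    have ht : Tendsto (fun m : ℕ => ((N + m : ℕ) : ℝ) ^ (-δ)) atTop (𝓝 0) := by
      refine (tendsto_rpow_neg_atTop hδ).comp ?_
      exact tendsto_natCast_atTop_atTop.comp (tendsto_atTop_mono (fun m => Nat.le_add_left m N) tendsto_id)
    simpa using ht.const_sub ((N : ℝ) ^ (-δ))
  · intro k
    rw [sub_nonneg]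
    exact Real.rpow_le_rpow_of_nonpos (hpos k) (by push_cast; linarith) (by linarith)

theorem hasSum_zetaStep_of_one_lt_re {N : ℕ} (hN : 1 ≤ N) {s : ℂ} (hs : 1 < s.re) :
    HasSum (fun k : ℕ => zetaStep (N + k) s)
      ((N : ℂ) ^ (1 - s) - (s - 1) *
        (riemannZeta s - ∑ k ∈ Finset.range N, ((k + 1 : ℕ) : ℂ) ^ (-s))) := by
  have hsum : Summable (fun k : ℕ => zetaStep (N + k) s) := by
    refine Summable.of_norm_bounded
      ((hasSum_rpow_neg_sub hN (by linarith : 0 < s.re)).summable.mul_left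
        (‖s - 1‖ * ‖s‖ / s.re)) fun k => ?_
    exact norm_zetaStep_le (by omega) (by linarith) le_rfl
  have hpart : ∀ m : ℕ, ∑ k ∈ Finset.range m, zetaStep (N + k) s
      = (N : ℂ) ^ (1 - s) - ((N + m : ℕ) : ℂ) ^ (1 - s) - (s - 1) *
        (∑ k ∈ Finset.range (N + m), ((k + 1 : ℕ) : ℂ) ^ (-s)
          - ∑ k ∈ Finset.range N, ((k + 1 : ℕ) : ℂ) ^ (-s)) := by
    intro m
    induction m with
    | zero => simp
    | succ m ih =>
      rw [Finset.sum_range_succ, ih, ← add_assoc, Finset.sum_range_succ, zetaStep]; ring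
  have hζ : Tendsto (fun m : ℕ => ∑ k ∈ Finset.range m, ((k + 1 : ℕ) : ℂ) ^ (-s)) atTop
      (𝓝 (riemannZeta s)) := by
    have h1 : Summable (fun n : ℕ => 1 / ((n : ℂ) + 1) ^ s) := by
      have := (summable_nat_add_iff 1).2 (Complex.summable_one_div_nat_cpow.2 hs)
      simpa using this
    rw [zeta_eq_tsum_one_div_nat_add_one_cpow hs]
    refine h1.hasSum.tendsto_sum_nat.congr fun m => Finset.sum_congr rfl fun k _ => ?_
    rw [Complex.cpow_neg]; push_cast; simp
  have hshift : Tendsto (fun m : ℕ => N + m) atTop atTop :=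
    tendsto_atTop_mono (fun m => Nat.le_add_left m N) tendsto_id
  have h0 : Tendsto (fun m : ℕ => ((N + m : ℕ) : ℂ) ^ (1 - s)) atTop (𝓝 0) := by
    rw [tendsto_zero_iff_norm_tendsto_zero]
    have : Tendsto (fun m : ℕ => ((N + m : ℕ) : ℝ) ^ (-(s.re - 1))) atTop (𝓝 0) :=
      (tendsto_rpow_neg_atTop (by linarith)).comp (tendsto_natCast_atTop_atTop.comp hshift)
    refine this.congr fun m => ?_
    rw [Complex.norm_natCast_cpow_of_pos (by omega)]
    congr 1; simp
  have hlim := hsum.hasSum.tendsto_sum_nat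
  have hlim' : Tendsto (fun m : ℕ => ∑ k ∈ Finset.range m, zetaStep (N + k) s) atTop
      (𝓝 ((N : ℂ) ^ (1 - s) - 0 - (s - 1) *
        (riemannZeta s - ∑ k ∈ Finset.range N, ((k + 1 : ℕ) : ℂ) ^ (-s)))) := by
    simp only [hpart]
    exact (h0.const_sub _).sub (((hζ.comp hshift).sub_const _).const_mul _)
  have := hsum.hasSum
  rwa [tendsto_nhds_unique hlim hlim', sub_zero] at this

theorem differentiable_zetaStep {n : ℕ} (hn : 1 ≤ n) : Differentiable ℂ (zetaStep n) := by
  have h1 : (n : ℂ) ≠ 0 := Nat.cast_ne_zero.2 (by omega)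
  have h2 : ((n + 1 : ℕ) : ℂ) ≠ 0 := Nat.cast_ne_zero.2 (by omega)
  have d : ∀ c : ℂ, c ≠ 0 → ∀ f : ℂ → ℂ, Differentiable ℂ f → Differentiable ℂ fun s => c ^ f s :=
    fun c hc f hf => hf.const_cpow (Or.inl hc)
  unfold zetaStep
  exact ((d _ h1 _ (by fun_prop)).sub (d _ h2 _ (by fun_prop))).sub
    ((by fun_prop : Differentiable ℂ fun s : ℂ => s - 1).mul (d _ h2 _ (by fun_prop)))

/-- Both sides are analytic for `Re s > 0` and agree by telescoping for `Re s > 1`, so the identity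
theorem applies. Working with `(s-1) ζ(s)` removes the pole from the region. -/
theorem riemannZeta₁_eq_sum_sub_tsum_zetaStep {N : ℕ} (hN : 1 ≤ N) {s : ℂ} (hs : 0 < s.re) :
    riemannZeta₁ s = (s - 1) * ∑ k ∈ Finset.range N, ((k + 1 : ℕ) : ℂ) ^ (-s)
      + (N : ℂ) ^ (1 - s) - ∑' k : ℕ, zetaStep (N + k) s := by
  obtain ⟨δ, hδ0, hδ⟩ : ∃ δ : ℝ, 0 < δ ∧ δ < min s.re 1 :=
    ⟨min s.re 1 / 2, by positivity, half_lt_self (by positivity)⟩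
  obtain ⟨R, hR⟩ : ∃ R : ℝ, max ‖s‖ 2 < R := exists_gt _
  -- A convex open set joining `s` to the point `2`; both cuts are needed for a uniform summable
  -- majorant.
  set V : Set ℂ := {z : ℂ | δ < z.re} ∩ Metric.ball 0 R with hV
  have hVo : IsOpen V := (isOpen_lt continuous_const Complex.continuous_re).inter Metric.isOpen_ball
  have hVc : Convex ℝ V := (convex_halfSpace_re_gt δ).inter (convex_ball 0 R)
  have hsV : s ∈ V := ⟨hδ.trans_le (min_le_left _ _), by
    simpa using (le_max_left _ _).trans_lt hR⟩
  have h2V : (2 : ℂ) ∈ V := ⟨by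
    have := hδ.trans_le (min_le_right _ _); simp; linarith, by
    simpa using (le_max_right _ _).trans_lt hR⟩
  have hR0 : 0 < R := lt_of_le_of_lt (by positivity) hR
  have hts : DifferentiableOn ℂ (fun z => ∑' k : ℕ, zetaStep (N + k) z) V := by
    refine Complex.differentiableOn_tsum_of_summable_norm
      ((hasSum_rpow_neg_sub hN hδ0).summable.mul_left ((R + 1) * R / δ))
      (fun k => (differentiable_zetaStep (by omega)).differentiableOn) hVo fun k z hz => ?_
    have hzR : ‖z‖ ≤ R := (mem_ball_zero_iff.1 hz.2).le
    have hz1 : ‖z - 1‖ ≤ R + 1 := (norm_sub_le _ _).trans (by simpa using hzR)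
    refine (norm_zetaStep_le (by omega) hδ0 hz.1.le).trans ?_
    have hnn : 0 ≤ ((N + k : ℕ) : ℝ) ^ (-δ) - ((N + k + 1 : ℕ) : ℝ) ^ (-δ) := by
      rw [sub_nonneg]
      exact Real.rpow_le_rpow_of_nonpos (by exact_mod_cast (by omega)) (by push_cast; linarith)
        (by linarith)
    gcongr
  have hpow : ∀ c : ℂ, c ≠ 0 → ∀ f : ℂ → ℂ, Differentiable ℂ f → Differentiable ℂ fun s => c ^ f s :=
    fun c hc f hf => hf.const_cpow (Or.inl hc)
  have hN0 : (N : ℂ) ≠ 0 := Nat.cast_ne_zero.2 (by omega)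
  have hg : DifferentiableOn ℂ (fun z : ℂ => (z - 1) * ∑ k ∈ Finset.range N,
      ((k + 1 : ℕ) : ℂ) ^ (-z) + (N : ℂ) ^ (1 - z) - ∑' k : ℕ, zetaStep (N + k) z) V := by
    refine (((by fun_prop : Differentiable ℂ fun z : ℂ => z - 1).mul
      (Differentiable.fun_sum fun k _ => hpow _ (Nat.cast_ne_zero.2 (by omega)) _ (by fun_prop))).add
      (hpow _ hN0 _ (by fun_prop))).differentiableOn.sub hts
  refine AnalyticOnNhd.eqOn_of_preconnected_of_eventuallyEq
    (differentiable_riemannZeta₁.differentiableOn.analyticOnNhd hVo) (hg.analyticOnNhd hVo)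
    hVc.isPreconnected h2V ?_ hsV
  have hnhds : {z : ℂ | 1 < z.re} ∈ 𝓝 (2 : ℂ) :=
    (isOpen_lt continuous_const Complex.continuous_re).mem_nhds (by simp)
  filter_upwards [hnhds] with z hz
  have hz1 : z ≠ 1 := by rintro rfl; simp at hz
  rw [(hasSum_zetaStep_of_one_lt_re hN hz).tsum_eq, riemannZeta_eq_inv_sub_mul hz1]
  have : z - 1 ≠ 0 := sub_ne_zero.2 hz1
  field_simp
  ring

/-- Approximation of `ζ` by its partial sums in the right half plane. -/
theorem norm_riemannZeta_sub_sum_sub_le {N : ℕ} (hN : 1 ≤ N) {s : ℂ} (hs : 0 < s.re)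
    (hs1 : s ≠ 1) :
    ‖riemannZeta s - ∑ k ∈ Finset.range N, ((k + 1 : ℕ) : ℂ) ^ (-s) - (N : ℂ) ^ (1 - s) / (s - 1)‖
      ≤ ‖s‖ / s.re * (N : ℝ) ^ (-s.re) := by
  have h1 : s - 1 ≠ 0 := sub_ne_zero.2 hs1
  have heq : riemannZeta s - ∑ k ∈ Finset.range N, ((k + 1 : ℕ) : ℂ) ^ (-s)
      - (N : ℂ) ^ (1 - s) / (s - 1) = -(s - 1)⁻¹ * ∑' k : ℕ, zetaStep (N + k) s := by
    rw [riemannZeta_eq_inv_sub_mul hs1, riemannZeta₁_eq_sum_sub_tsum_zetaStep hN hs]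
    field_simp
    ring
  have hb := tsum_of_norm_bounded
    ((hasSum_rpow_neg_sub hN hs).mul_left (‖s - 1‖ * ‖s‖ / s.re))
    (fun k => norm_zetaStep_le (n := N + k) (by omega) hs le_rfl)
  rw [heq, norm_mul, norm_neg, norm_inv]
  have h2 : 0 < ‖s - 1‖ := norm_pos_iff.2 h1
  calc ‖s - 1‖⁻¹ * ‖∑' k : ℕ, zetaStep (N + k) s‖
      ≤ ‖s - 1‖⁻¹ * (‖s - 1‖ * ‖s‖ / s.re * (N : ℝ) ^ (-s.re)) := by gcongr
    _ = _ := by field_simp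

/-! ### Fourier positivity under multiplication by geometric series. -/

/-- Real part of the Fourier integral of `W` over `[-T, T]`. -/
noncomputable def reFourier (T : ℝ) (W : ℝ → ℂ) (u : ℝ) : ℝ :=
  (∫ t in (-T)..T, Complex.exp (u * t * Complex.I) * W t).re

theorem reFourier_add {T : ℝ} {V W : ℝ → ℂ} (hV : Continuous V) (hW : Continuous W) (u : ℝ) :
    reFourier T (fun t => V t + W t) u = reFourier T V u + reFourier T W u := by
  unfold reFourier
  rw [← Complex.add_re, ← intervalIntegral.integral_add]
  · simp only [mul_add]
  · exact (by fun_prop : Continuous _).intervalIntegrable _ _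
  · exact (by fun_prop : Continuous _).intervalIntegrable _ _

theorem reFourier_ofReal {T : ℝ} {w : ℝ → ℝ} (hw : Continuous w) (u : ℝ) :
    reFourier T (fun t => (w t : ℂ)) u = ∫ t in (-T)..T, w t * Real.cos (u * t) := by
  unfold reFourier
  have h := Complex.reCLM.intervalIntegral_comp_comm (μ := MeasureTheory.volume) (a := -T) (b := T)
    (f := fun t : ℝ => Complex.exp (u * t * Complex.I) * (w t : ℂ))
    ((by fun_prop : Continuous _).intervalIntegrable _ _)
  rw [Complex.reCLM_apply] at h
  rw [← h]
  congr 1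
  ext t
  rw [Complex.reCLM_apply, Complex.re_mul_ofReal, ← Complex.ofReal_mul, Complex.exp_ofReal_mul_I_re,
    mul_comm]

theorem abs_reFourier_le {T : ℝ} (hT : 0 ≤ T) (W : ℝ → ℂ) (u : ℝ) :
    |reFourier T W u| ≤ ∫ t in (-T)..T, ‖W t‖ := by
  refine (Complex.abs_re_le_norm _).trans
    ((intervalIntegral.norm_integral_le_integral_norm (by linarith)).trans_eq ?_)
  congr 1
  ext t
  rw [norm_mul, ← Complex.ofReal_mul, Complex.norm_exp_ofReal_mul_I, one_mul]

/-- The sum of the geometric series `∑ 2⁻ᵏ e^{ikat}`. -/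
noncomputable def geomFactor (a t : ℝ) : ℂ := (1 - Complex.exp (a * t * Complex.I) / 2)⁻¹

theorem half_le_norm_one_sub_exp_half (a t : ℝ) :
    1 / 2 ≤ ‖1 - Complex.exp (a * t * Complex.I) / 2‖ := by
  have h : ‖Complex.exp (a * t * Complex.I) / 2‖ = 1 / 2 := by
    rw [norm_div, ← Complex.ofReal_mul, Complex.norm_exp_ofReal_mul_I]; simp
  have := norm_sub_norm_le (1 : ℂ) (Complex.exp (a * t * Complex.I) / 2)
  rw [h, norm_one] at this
  linarith

theorem one_sub_exp_half_ne_zero (a t : ℝ) : 1 - Complex.exp (a * t * Complex.I) / 2 ≠ 0 :=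
  norm_pos_iff.1 (by linarith [half_le_norm_one_sub_exp_half a t])

theorem norm_geomFactor_le (a t : ℝ) : ‖geomFactor a t‖ ≤ 2 := by
  have h := half_le_norm_one_sub_exp_half a t
  rw [geomFactor, norm_inv]
  exact inv_le_of_inv_le₀ (by norm_num) (by linarith)

theorem continuous_geomFactor (a : ℝ) : Continuous (geomFactor a) :=
  (by fun_prop : Continuous fun t : ℝ => 1 - Complex.exp (a * t * Complex.I) / 2).inv₀
    (one_sub_exp_half_ne_zero a)

theorem geomFactor_neg (a t : ℝ) : geomFactor (-a) t = (starRingEnd ℂ) (geomFactor a t) := by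
  simp [geomFactor, ← Complex.exp_conj, Complex.conj_ofNat]

theorem geomFactor_mul_neg (a t : ℝ) :
    geomFactor a t * geomFactor (-a) t = ((‖geomFactor a t‖ ^ 2 : ℝ) : ℂ) := by
  rw [geomFactor_neg, Complex.mul_conj, Complex.normSq_eq_norm_sq]

/-- The product `V = W · geomFactor a` satisfies `V = W + (e^{iat}/2) V`, and the exponential shifts
the frequency by `a`. -/
theorem reFourier_mul_geomFactor {T : ℝ} {W : ℝ → ℂ} (hW : Continuous W) (a u : ℝ) :
    reFourier T (fun t => W t * geomFactor a t) u
      = reFourier T W u + reFourier T (fun t => W t * geomFactor a t) (u + a) / 2 := by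
  have hc := continuous_geomFactor a
  have h1 : reFourier T (fun t => W t * geomFactor a t) (u + a) / 2 = reFourier T
      (fun t => (W t * geomFactor a t) * (Complex.exp (a * t * Complex.I) / 2)) u := by
    unfold reFourier
    rw [← Complex.div_ofNat_re, ← intervalIntegral.integral_div]
    congr 2
    ext t
    have : Complex.exp (((u + a : ℝ) : ℂ) * t * Complex.I)
        = Complex.exp (u * t * Complex.I) * Complex.exp (a * t * Complex.I) := by
      rw [← Complex.exp_add]; congr 1; push_cast; ring
    rw [this]; ring
  rw [h1, ← reFourier_add hW (by fun_prop)]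
  congr 1
  ext t
  have := one_sub_exp_half_ne_zero a t
  have h2 : geomFactor a t * (1 - Complex.exp (a * t * Complex.I) / 2) = 1 :=
    inv_mul_cancel₀ this
  linear_combination W t * h2

theorem reFourier_mul_geomFactor_nonneg {T : ℝ} (hT : 0 ≤ T) {W : ℝ → ℂ} (hW : Continuous W)
    (hpos : ∀ u, 0 ≤ reFourier T W u) (a u : ℝ) :
    0 ≤ reFourier T (fun t => W t * geomFactor a t) u := by
  set V : ℝ → ℂ := fun t => W t * geomFactor a t with hV
  set C := ∫ t in (-T)..T, ‖V t‖
  have hstep : ∀ v, reFourier T V (v + a) / 2 ≤ reFourier T V v := fun v => by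
    rw [reFourier_mul_geomFactor hW a v]; linarith [hpos v]
  -- Iterating the recursion moves a possibly negative value to a far frequency with weight
  -- `2^{-k}`. The transform is bounded by `C`, so the negative part vanishes in the limit; no
  -- infinite series has to be integrated.
  have hiter : ∀ k : ℕ, ∀ v, reFourier T V (v + k * a) * (1 / 2) ^ k ≤ reFourier T V v := by
    intro k
    induction k with
    | zero => simp
    | succ k ih =>
      intro v
      refine le_trans ?_ (ih v)
      have := hstep (v + k * a)
      rw [add_assoc] at this
      have e : v + ((k + 1 : ℕ) : ℝ) * a = v + (k * a + a) := by push_cast; ring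
      rw [e, pow_succ]
      nlinarith [pow_pos (by norm_num : (0 : ℝ) < 1 / 2) k]
  have hbound : ∀ k : ℕ, -C * (1 / 2) ^ k ≤ reFourier T V u := fun k => by
    refine le_trans ?_ (hiter k u)
    have := (abs_le.1 (abs_reFourier_le hT V (u + k * a))).1
    gcongr
  have hlim : Tendsto (fun k : ℕ => -C * (1 / 2 : ℝ) ^ k) atTop (𝓝 (-C * 0)) :=
    (tendsto_pow_atTop_nhds_zero_of_lt_one (by norm_num) (by norm_num)).const_mul _
  rw [mul_zero] at hlim
  exact le_of_tendsto' hlim hbound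

theorem reFourier_le_mul_geomFactor {T : ℝ} (hT : 0 ≤ T) {W : ℝ → ℂ} (hW : Continuous W)
    (hpos : ∀ u, 0 ≤ reFourier T W u) (a u : ℝ) :
    reFourier T W u ≤ reFourier T (fun t => W t * geomFactor a t) u := by
  rw [reFourier_mul_geomFactor hW a u]
  linarith [reFourier_mul_geomFactor_nonneg hT hW hpos a (u + a)]

theorem half_reFourier_le_mul_geomFactor {T : ℝ} {W : ℝ → ℂ} (hW : Continuous W)
    (hpos : ∀ u, 0 ≤ reFourier T W u) (a u : ℝ) :
    reFourier T (fun t => W t * geomFactor a t) (u + a) / 2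
      ≤ reFourier T (fun t => W t * geomFactor a t) u := by
  rw [reFourier_mul_geomFactor hW a u]
  linarith [hpos u]

/-! ### The Fejér kernel and the resonator weight. -/

theorem integral_triangle_mul_cos {T u : ℝ} (hT : 0 ≤ T) (hu : u ≠ 0) :
    ∫ t in (-T)..T, (T - |t|) * Real.cos (u * t) = 2 * (1 - Real.cos (u * T)) / u ^ 2 := by
  have hi : ∀ a b : ℝ, IntervalIntegrable (fun t => (T - |t|) * Real.cos (u * t))
      MeasureTheory.volume a b := fun a b => (by fun_prop : Continuous _).intervalIntegrable _ _
  have hright : ∫ t in (0 : ℝ)..T, (T - |t|) * Real.cos (u * t)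
      = (1 - Real.cos (u * T)) / u ^ 2 := by
    have h : ∫ t in (0 : ℝ)..T, (T - |t|) * Real.cos (u * t)
        = ∫ t in (0 : ℝ)..T, (T - t) * Real.cos (u * t) := by
      refine intervalIntegral.integral_congr fun t ht => ?_
      rw [Set.uIcc_of_le hT] at ht
      simp only [abs_of_nonneg ht.1]
    rw [h, intervalIntegral.integral_eq_sub_of_hasDerivAt
      (f := fun t => (T - t) * (Real.sin (u * t) / u) - Real.cos (u * t) / u ^ 2)]
    · simp; ring
    · intro t _
      have h1 : HasDerivAt (fun t : ℝ => u * t) u t := by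
        simpa using (hasDerivAt_id t).const_mul u
      refine ((((hasDerivAt_id t).const_sub T).mul (h1.sin.div_const u)).sub
        (h1.cos.div_const (u ^ 2))).congr_deriv ?_
      simp only [id]
      field_simp
      ring
    · exact (by fun_prop : Continuous _).intervalIntegrable _ _
  have hleft : ∫ t in (-T)..0, (T - |t|) * Real.cos (u * t)
      = ∫ t in (0 : ℝ)..T, (T - |t|) * Real.cos (u * t) := by
    have := intervalIntegral.integral_comp_neg (a := 0) (b := T)
      (fun t => (T - |t|) * Real.cos (u * t))
    rw [neg_zero] at this
    rw [← this]
    simp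
  rw [← intervalIntegral.integral_add_adjacent_intervals (hi _ 0) (hi 0 _), hleft, hright]
  ring

theorem integral_triangle {T : ℝ} (hT : 0 ≤ T) : ∫ t in (-T)..T, (T - |t|) = T ^ 2 := by
  have hi : ∀ a b : ℝ, IntervalIntegrable (fun t : ℝ => T - |t|)
      MeasureTheory.volume a b := fun a b => (by fun_prop : Continuous _).intervalIntegrable _ _
  have hright : ∫ t in (0 : ℝ)..T, (T - |t|) = T ^ 2 / 2 := by
    have h : ∫ t in (0 : ℝ)..T, (T - |t|) = ∫ t in (0 : ℝ)..T, (T - t) := by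
      refine intervalIntegral.integral_congr fun t ht => ?_
      rw [Set.uIcc_of_le hT] at ht
      simp only [abs_of_nonneg ht.1]
    rw [h, intervalIntegral.integral_sub (by simp) (by simp)]
    simp
    ring
  have hleft : ∫ t in (-T)..0, (T - |t|) = ∫ t in (0 : ℝ)..T, (T - |t|) := by
    have := intervalIntegral.integral_comp_neg (a := 0) (b := T) (fun t => T - |t|)
    rw [neg_zero] at this
    rw [← this]
    simp
  rw [← intervalIntegral.integral_add_adjacent_intervals (hi _ 0) (hi 0 _), hleft, hright]
  ring

theorem reFourier_triangle_zero {T : ℝ} (hT : 0 ≤ T) :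
    reFourier T (fun t => ((T - |t| : ℝ) : ℂ)) 0 = T ^ 2 := by
  rw [reFourier_ofReal (by fun_prop)]
  simpa using integral_triangle hT

theorem reFourier_triangle_nonneg {T : ℝ} (hT : 0 ≤ T) (u : ℝ) :
    0 ≤ reFourier T (fun t => ((T - |t| : ℝ) : ℂ)) u := by
  rcases eq_or_ne u 0 with rfl | hu
  · rw [reFourier_triangle_zero hT]; positivity
  · rw [reFourier_ofReal (by fun_prop), integral_triangle_mul_cos hT hu]
    have := Real.cos_le_one (u * T)
    have : 0 ≤ 1 - Real.cos (u * T) := by linarith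
    positivity

/-- The triangular kernel weighted by `|R(t)|²`, where `R(t) = ∏ (1 - p^{it} / 2)⁻¹`, `p ∈ S`. -/
noncomputable def resonatorWeight (T : ℝ) (S : Finset ℕ) (t : ℝ) : ℝ :=
  (T - |t|) * ∏ p ∈ S, ‖geomFactor (Real.log p) t‖ ^ 2

theorem continuous_resonatorWeight (T : ℝ) (S : Finset ℕ) :
    Continuous (resonatorWeight T S) := by
  have h : ∀ p : ℕ, Continuous (geomFactor (Real.log p)) := fun p => continuous_geomFactor _
  unfold resonatorWeight
  fun_prop

theorem resonatorWeight_nonneg {T : ℝ} (S : Finset ℕ) {t : ℝ} (ht : |t| ≤ T) :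
    0 ≤ resonatorWeight T S t :=
  mul_nonneg (by linarith) (Finset.prod_nonneg fun _ _ => by positivity)

theorem resonatorWeight_le {T : ℝ} (S : Finset ℕ) {t : ℝ} (ht : |t| ≤ T) :
    resonatorWeight T S t ≤ T * 4 ^ S.card := by
  have h : ∏ p ∈ S, ‖geomFactor (Real.log p) t‖ ^ 2 ≤ 4 ^ S.card := by
    refine Finset.prod_le_prod (fun _ _ => by positivity) (fun p _ => ?_) |>.trans_eq
      (Finset.prod_const (4 : ℝ))
    have := norm_geomFactor_le (Real.log p) t
    nlinarith [norm_nonneg (geomFactor (Real.log p) t)]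
  have h0 : 0 ≤ |t| := abs_nonneg t
  have h1 : 0 ≤ ∏ p ∈ S, ‖geomFactor (Real.log p) t‖ ^ 2 :=
    Finset.prod_nonneg fun _ _ => by positivity
  unfold resonatorWeight
  gcongr <;> linarith

/-- Splitting `|g|²` as `conj g · g` exhibits it as two geometric factors, of frequencies `-log p`
and `log p`, to which the positivity lemmas apply one at a time. -/
theorem resonatorWeight_insert {T : ℝ} {S : Finset ℕ} {p : ℕ} (hp : p ∉ S) (t : ℝ) :
    (resonatorWeight T (insert p S) t : ℂ) =
      resonatorWeight T S t * geomFactor (-Real.log p) t * geomFactor (Real.log p) t := by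
  rw [mul_assoc, mul_comm (geomFactor (-_) t), geomFactor_mul_neg, ← Complex.ofReal_mul,
    resonatorWeight, resonatorWeight, Finset.prod_insert hp]
  congr 1
  ring

theorem reFourier_triangle_le_resonatorWeight {T : ℝ} (hT : 0 ≤ T) (S : Finset ℕ) (u : ℝ) :
    reFourier T (fun t => ((T - |t| : ℝ) : ℂ)) u
      ≤ reFourier T (fun t => (resonatorWeight T S t : ℂ)) u := by
  induction S using Finset.induction_on generalizing u with
  | empty => simp [resonatorWeight]
  | insert p S hp ih =>
    have hc : Continuous fun t => (resonatorWeight T S t : ℂ) :=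
      Complex.continuous_ofReal.comp (continuous_resonatorWeight T S)
    have hpos : ∀ v, 0 ≤ reFourier T (fun t => (resonatorWeight T S t : ℂ)) v := fun v =>
      (reFourier_triangle_nonneg hT v).trans (ih v)
    simp only [resonatorWeight_insert hp]
    refine (ih u).trans ((reFourier_le_mul_geomFactor hT hc hpos (-Real.log p) u).trans ?_)
    exact reFourier_le_mul_geomFactor hT (hc.mul (continuous_geomFactor _))
      (reFourier_mul_geomFactor_nonneg hT hc hpos _) _ u

theorem reFourier_resonatorWeight_nonneg {T : ℝ} (hT : 0 ≤ T) (S : Finset ℕ) (u : ℝ) :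
    0 ≤ reFourier T (fun t => (resonatorWeight T S t : ℂ)) u :=
  (reFourier_triangle_nonneg hT u).trans (reFourier_triangle_le_resonatorWeight hT S u)

/-- The factor of frequency `log p` is taken out last: what remains still has a nonnegative
transform, so its contribution to the recursion can be dropped. -/
theorem half_reFourier_resonatorWeight_le {T : ℝ} (hT : 0 ≤ T) {S : Finset ℕ} {p : ℕ}
    (hp : p ∈ S) (u : ℝ) :
    reFourier T (fun t => (resonatorWeight T S t : ℂ)) (u + Real.log p) / 2
      ≤ reFourier T (fun t => (resonatorWeight T S t : ℂ)) u := by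
  rw [← Finset.insert_erase hp]
  simp only [resonatorWeight_insert (Finset.notMem_erase p S)]
  have hc : Continuous fun t => (resonatorWeight T (S.erase p) t : ℂ) :=
    Complex.continuous_ofReal.comp (continuous_resonatorWeight T _)
  exact half_reFourier_le_mul_geomFactor (hc.mul (continuous_geomFactor _))
    (reFourier_mul_geomFactor_nonneg hT hc (reFourier_resonatorWeight_nonneg hT _) _) _ u

theorem reFourier_resonatorWeight_prod {T : ℝ} (hT : 0 ≤ T) {S A : Finset ℕ} (hA : A ⊆ S)
    (hS : ∀ p ∈ S, 0 < p) :
    reFourier T (fun t => (resonatorWeight T S t : ℂ)) 0 * (1 / 2) ^ A.card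
      ≤ reFourier T (fun t => (resonatorWeight T S t : ℂ)) (-Real.log (∏ p ∈ A, p : ℕ)) := by
  induction A using Finset.induction_on with
  | empty => simp
  | insert p A hp ih =>
    have hpS : p ∈ S := hA (Finset.mem_insert_self p A)
    have hAS : A ⊆ S := (Finset.subset_insert p A).trans hA
    have hpos : (∏ q ∈ A, q : ℕ) ≠ 0 :=
      Finset.prod_ne_zero_iff.2 fun q hq => (hS q (hAS hq)).ne'
    have hp0 : p ≠ 0 := (hS p hpS).ne'
    refine le_trans ?_ (half_reFourier_resonatorWeight_le hT hpS _)
    have e : -Real.log (∏ q ∈ insert p A, q : ℕ) + Real.log p = -Real.log (∏ q ∈ A, q : ℕ) := by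
      rw [Finset.prod_insert hp, Nat.cast_mul, Real.log_mul (by exact_mod_cast hp0)
        (by exact_mod_cast hpos)]
      ring
    rw [e, Finset.card_insert_of_notMem hp, pow_succ]
    linarith [ih hAS]

/-! ### The resonance inequality. -/

theorem re_natCast_cpow_neg {n : ℕ} (hn : 0 < n) (α t : ℝ) :
    ((n : ℂ) ^ (-((α : ℂ) + t * Complex.I))).re
      = (n : ℝ) ^ (-α) * Real.cos (-Real.log n * t) := by
  have hn' : (0 : ℝ) < n := by exact_mod_cast hn
  have hn0 : (n : ℂ) ≠ 0 := Nat.cast_ne_zero.2 hn.ne'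
  have e : (n : ℂ) ^ (-((α : ℂ) + t * Complex.I))
      = (((n : ℝ) ^ (-α) : ℝ) : ℂ) * Complex.exp (((-Real.log n * t : ℝ) : ℂ) * Complex.I) := by
    rw [neg_add, Complex.cpow_add _ _ hn0, Complex.ofReal_cpow hn'.le]
    congr 1
    · push_cast; rfl
    · rw [Complex.cpow_def_of_ne_zero hn0, ← Complex.natCast_log]
      congr 1; push_cast; ring
  rw [e, Complex.re_ofReal_mul, Complex.exp_ofReal_mul_I_re]

theorem integral_inv_sqrt_one_add_sq (T : ℝ) :
    ∫ t in (-T)..T, (√(1 + t ^ 2))⁻¹ = 2 * Real.arsinh T := by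
  rw [intervalIntegral.integral_eq_sub_of_hasDerivAt (f := Real.arsinh)
    (fun t _ => Real.hasDerivAt_arsinh t)]
  · rw [Real.arsinh_neg]; ring
  · refine Continuous.intervalIntegrable (Continuous.inv₀ (by fun_prop) fun t => ?_) _ _
    positivity

/-- The majorant is a multiple of the derivative of `arsinh`, so the pole term integrates to a
quantity of size `log T`. -/
theorem inv_norm_sub_one_le {α : ℝ} (h0 : 0 < α) (h1 : α < 1) (t : ℝ) :
    ‖((α : ℂ) + t * Complex.I) - 1‖⁻¹ ≤ (1 - α)⁻¹ * (√(1 + t ^ 2))⁻¹ := by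
  rw [← mul_inv]
  have hpos : 0 < (1 - α) * √(1 + t ^ 2) := mul_pos (by linarith) (by positivity)
  refine inv_anti₀ hpos ?_
  have e : ((α : ℂ) + t * Complex.I) - 1 = ((α - 1 : ℝ) : ℂ) + t * Complex.I := by
    push_cast; ring
  rw [e, Complex.norm_add_mul_I]
  refine Real.le_sqrt_of_sq_le ?_
  rw [mul_pow, Real.sq_sqrt (by positivity)]
  have h : (1 - α) ^ 2 ≤ 1 := by nlinarith
  nlinarith [mul_le_mul_of_nonneg_right h (sq_nonneg t)]

theorem re_sum_cpow_le {α T M t : ℝ} (h0 : 0 < α) (h1 : α < 1) {N : ℕ} (hN : 1 ≤ N)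
    (ht : |t| ≤ T) (hM : ‖riemannZeta ((α : ℂ) + t * Complex.I)‖ ≤ M) :
    ∑ k ∈ Finset.range N, ((k + 1 : ℕ) : ℝ) ^ (-α) * Real.cos (-Real.log (k + 1 : ℕ) * t)
      ≤ M + (1 + T) / α * (N : ℝ) ^ (-α)
        + (N : ℝ) ^ (1 - α) * ((1 - α)⁻¹ * (√(1 + t ^ 2))⁻¹) := by
  set s : ℂ := (α : ℂ) + t * Complex.I with hs
  have hre : s.re = α := by simp [hs]
  have hs1 : s ≠ 1 := fun h => by rw [h] at hre; simp at hre; linarith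
  have happ := norm_riemannZeta_sub_sum_sub_le hN (s := s) (by rw [hre]; exact h0) hs1
  have hsn : ‖s‖ ≤ 1 + T := by
    refine (norm_add_le _ _).trans ?_
    rw [norm_mul, Complex.norm_I, Complex.norm_real, Complex.norm_real, Real.norm_eq_abs,
      Real.norm_eq_abs, abs_of_pos h0]
    linarith
  have hsum : ∑ k ∈ Finset.range N, ((k + 1 : ℕ) : ℝ) ^ (-α) * Real.cos (-Real.log (k + 1 : ℕ) * t)
      = (∑ k ∈ Finset.range N, ((k + 1 : ℕ) : ℂ) ^ (-s)).re := by
    rw [Complex.re_sum]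
    exact Finset.sum_congr rfl fun k _ => (re_natCast_cpow_neg (Nat.succ_pos k) α t).symm
  have hpole : ‖(N : ℂ) ^ (1 - s) / (s - 1)‖
      ≤ (N : ℝ) ^ (1 - α) * ((1 - α)⁻¹ * (√(1 + t ^ 2))⁻¹) := by
    rw [norm_div, Complex.norm_natCast_cpow_of_pos (by omega), Complex.sub_re, hre,
      Complex.one_re, div_eq_mul_inv]
    gcongr
    exact inv_norm_sub_one_le h0 h1 t
  rw [hre] at happ
  have herr : ‖s‖ / α * (N : ℝ) ^ (-α) ≤ (1 + T) / α * (N : ℝ) ^ (-α) := by gcongr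
  set D := ∑ k ∈ Finset.range N, ((k + 1 : ℕ) : ℂ) ^ (-s)
  set Q := (N : ℂ) ^ (1 - s) / (s - 1)
  have hD : D = riemannZeta s - (riemannZeta s - D - Q) - Q := by ring
  have hDn : ‖D‖ ≤ ‖riemannZeta s‖ + ‖riemannZeta s - D - Q‖ + ‖Q‖ := by
    conv_lhs => rw [hD]
    exact (norm_sub_le _ _).trans (add_le_add_left (norm_sub_le _ _) _)
  rw [hsum]
  linarith [Complex.re_le_norm D]

theorem injOn_prod_primes {S : Finset ℕ} (hS : ∀ p ∈ S, p.Prime) :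
    Set.InjOn (fun A : Finset ℕ => ∏ p ∈ A, p) {A | A ⊆ S} := by
  intro A hA B hB h
  have := congrArg Nat.primeFactors h
  simp only at this
  rwa [Nat.primeFactors_prod fun p hp => hS p (hA hp),
    Nat.primeFactors_prod fun p hp => hS p (hB hp)] at this

/-- The resonance inequality: a bound for `ζ` on the segment `[α - iT, α + iT]` bounds sums
over products of distinct primes of `S`. -/
theorem resonance_inequality {α T M : ℝ} (h0 : 0 < α) (h1 : α < 1) (hT : 0 ≤ T) {N : ℕ}
    (hN : 1 ≤ N) {S : Finset ℕ} (hS : ∀ p ∈ S, p.Prime)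
    (hM : ∀ t : ℝ, |t| ≤ T → ‖riemannZeta ((α : ℂ) + t * Complex.I)‖ ≤ M)
    {𝒜 : Finset (Finset ℕ)} (h𝒜 : ∀ A ∈ 𝒜, A ⊆ S ∧ ∏ p ∈ A, p ≤ N) :
    reFourier T (fun t => (resonatorWeight T S t : ℂ)) 0 *
        ∑ A ∈ 𝒜, (1 / 2 : ℝ) ^ A.card * ((∏ p ∈ A, p : ℕ) : ℝ) ^ (-α)
      ≤ (M + (1 + T) / α * (N : ℝ) ^ (-α)) *
          reFourier T (fun t => (resonatorWeight T S t : ℂ)) 0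
        + (N : ℝ) ^ (1 - α) * (1 - α)⁻¹ * (T * 4 ^ S.card) * (2 * Real.arsinh T) := by
  set w := resonatorWeight T S with hw
  have hwc : Continuous w := continuous_resonatorWeight T S
  set F := reFourier T (fun t => (w t : ℂ)) with hF
  have hF0 : F 0 = ∫ t in (-T)..T, w t := by
    rw [hF, reFourier_ofReal hwc]; simp
  have hlow : F 0 * ∑ A ∈ 𝒜, (1 / 2 : ℝ) ^ A.card * ((∏ p ∈ A, p : ℕ) : ℝ) ^ (-α)
      ≤ ∑ k ∈ Finset.range N, ((k + 1 : ℕ) : ℝ) ^ (-α) * F (-Real.log (k + 1 : ℕ)) := by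
    have hprod : ∀ A ∈ 𝒜, 0 < ∏ p ∈ A, p := fun A hA =>
      Finset.prod_pos fun p hp => (hS p ((h𝒜 A hA).1 hp)).pos
    -- The index `k` stands for the integer `k + 1`, hence the subtraction of one; distinct sets of
    -- primes have distinct products.
    have hinj : Set.InjOn (fun A : Finset ℕ => ∏ p ∈ A, p - 1) 𝒜 := fun A hA B hB h => by
      have hA' := hprod A hA
      have hB' := hprod B hB
      exact injOn_prod_primes hS (h𝒜 A hA).1 (h𝒜 B hB).1 (by simp only at h ⊢; omega)
    have hsub : 𝒜.image (fun A : Finset ℕ => ∏ p ∈ A, p - 1) ⊆ Finset.range N := by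
      intro k hk
      obtain ⟨A, hA, rfl⟩ := Finset.mem_image.1 hk
      have := hprod A hA
      have := (h𝒜 A hA).2
      exact Finset.mem_range.2 (by omega)
    have hnn : ∀ k : ℕ, 0 ≤ ((k + 1 : ℕ) : ℝ) ^ (-α) * F (-Real.log (k + 1 : ℕ)) := fun k =>
      mul_nonneg (by positivity) (reFourier_resonatorWeight_nonneg hT S _)
    -- Positivity of the transform is what allows every other integer to be discarded.
    refine le_trans ?_ (Finset.sum_le_sum_of_subset_of_nonneg hsub fun k _ _ => hnn k)
    rw [Finset.sum_image hinj, Finset.mul_sum]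
    refine Finset.sum_le_sum fun A hA => ?_
    rw [Nat.sub_add_cancel (hprod A hA)]
    have := reFourier_resonatorWeight_prod hT (h𝒜 A hA).1 fun p hp => (hS p hp).pos
    calc F 0 * ((1 / 2 : ℝ) ^ A.card * ((∏ p ∈ A, p : ℕ) : ℝ) ^ (-α))
        = ((∏ p ∈ A, p : ℕ) : ℝ) ^ (-α) * (F 0 * (1 / 2 : ℝ) ^ A.card) := by ring
      _ ≤ _ := mul_le_mul_of_nonneg_left this (by positivity)
  have hint : ∑ k ∈ Finset.range N, ((k + 1 : ℕ) : ℝ) ^ (-α) * F (-Real.log (k + 1 : ℕ))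
      = ∫ t in (-T)..T, (∑ k ∈ Finset.range N,
          ((k + 1 : ℕ) : ℝ) ^ (-α) * Real.cos (-Real.log (k + 1 : ℕ) * t)) * w t := by
    simp only [Finset.sum_mul]
    rw [intervalIntegral.integral_finsetSum
      fun k _ => (by fun_prop : Continuous _).intervalIntegrable _ _]
    refine Finset.sum_congr rfl fun k _ => ?_
    rw [hF, reFourier_ofReal hwc, ← intervalIntegral.integral_const_mul]
    congr 1
    ext t
    ring
  have hsqrt : Continuous fun t : ℝ => (√(1 + t ^ 2))⁻¹ :=
    Continuous.inv₀ (by fun_prop) fun t => by positivity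
  have hmono : ∫ t in (-T)..T, (∑ k ∈ Finset.range N,
          ((k + 1 : ℕ) : ℝ) ^ (-α) * Real.cos (-Real.log (k + 1 : ℕ) * t)) * w t
      ≤ ∫ t in (-T)..T, ((M + (1 + T) / α * (N : ℝ) ^ (-α)) * w t
        + (N : ℝ) ^ (1 - α) * (1 - α)⁻¹ * (T * 4 ^ S.card) * (√(1 + t ^ 2))⁻¹) := by
    refine intervalIntegral.integral_mono_on (by linarith)
      ((by fun_prop : Continuous _).intervalIntegrable _ _)
      ((by fun_prop : Continuous _).intervalIntegrable _ _) fun t ht => ?_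
    have ht' : |t| ≤ T := abs_le.2 ht
    have hw0 : 0 ≤ w t := resonatorWeight_nonneg S ht'
    have hw1 : w t ≤ T * 4 ^ S.card := resonatorWeight_le S ht'
    have hb := mul_le_mul_of_nonneg_right (re_sum_cpow_le h0 h1 hN ht' (hM t ht')) hw0
    refine hb.trans ?_
    rw [add_mul]
    have h1' : 0 < 1 - α := by linarith
    -- The crude bound for `w` is spent on the pole term only; elsewhere `w` is kept, so that its
    -- integral `F 0` factors out.
    have : (N : ℝ) ^ (1 - α) * ((1 - α)⁻¹ * (√(1 + t ^ 2))⁻¹) * w t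
        ≤ (N : ℝ) ^ (1 - α) * ((1 - α)⁻¹ * (√(1 + t ^ 2))⁻¹) * (T * 4 ^ S.card) :=
      mul_le_mul_of_nonneg_left hw1 (by positivity)
    linarith
  refine hlow.trans (hint.trans_le (hmono.trans_eq ?_))
  rw [intervalIntegral.integral_add ((by fun_prop : Continuous _).intervalIntegrable _ _)
    ((by fun_prop : Continuous _).intervalIntegrable _ _), intervalIntegral.integral_const_mul,
    intervalIntegral.integral_const_mul, integral_inv_sqrt_one_add_sq, hF0]

/-! ### Truncating the sum over products of primes. -/

/-- Rankin's trick: on sets with more than `J` elements insert the factor `e^{|A| - J} ≥ 1`, then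
extend the sum to all subsets of `S`. -/
theorem one_add_pow_card_le_sum_powerset {S : Finset ℕ} {x : ℝ} (hx : 0 ≤ x) (J : ℕ) :
    (1 + x) ^ S.card ≤ ∑ A ∈ S.powerset with A.card ≤ J, x ^ A.card
      + Real.exp (Real.exp 1 * (S.card * x) - J) := by
  have hexpand : ∀ y : ℝ, ∑ A ∈ S.powerset, y ^ A.card = (1 + y) ^ S.card := fun y => by
    rw [← Finset.prod_const, Finset.prod_one_add]
    simp
  have htail : ∑ A ∈ S.powerset with ¬ A.card ≤ J, x ^ A.card
      ≤ Real.exp (Real.exp 1 * (S.card * x) - J) := by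
    calc ∑ A ∈ S.powerset with ¬ A.card ≤ J, x ^ A.card
        ≤ ∑ A ∈ S.powerset with ¬ A.card ≤ J, Real.exp (-J) * (Real.exp 1 * x) ^ A.card := by
          refine Finset.sum_le_sum fun A hA => ?_
          have hJ : J ≤ A.card := (not_le.1 (Finset.mem_filter.1 hA).2).le
          have h1 : 1 ≤ Real.exp (-J) * Real.exp 1 ^ A.card := by
            rw [← Real.exp_nat_mul, mul_one, ← Real.exp_add]
            have : (J : ℝ) ≤ A.card := by exact_mod_cast hJ
            exact Real.one_le_exp (by linarith)
          rw [mul_pow, ← mul_assoc]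
          exact le_mul_of_one_le_left (by positivity) h1
      _ ≤ ∑ A ∈ S.powerset, Real.exp (-J) * (Real.exp 1 * x) ^ A.card :=
          Finset.sum_le_sum_of_subset_of_nonneg (Finset.filter_subset _ _)
            fun A _ _ => by positivity
      _ = Real.exp (-J) * (1 + Real.exp 1 * x) ^ S.card := by
          rw [← Finset.mul_sum, hexpand]
      _ ≤ Real.exp (-J) * Real.exp (Real.exp 1 * x) ^ S.card := by
          gcongr
          linarith [Real.add_one_le_exp (Real.exp 1 * x)]
      _ = _ := by
          rw [← Real.exp_nat_mul, ← Real.exp_add]; congr 1; ring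
  rw [← hexpand, ← Finset.sum_filter_add_sum_filter_not S.powerset (fun A => A.card ≤ J)]
  linarith

theorem one_add_pow_card_le {α P : ℝ} (h0 : 0 < α) (hP : 1 ≤ P) {S : Finset ℕ}
    (hS : ∀ p ∈ S, p.Prime) (hSP : ∀ p ∈ S, (p : ℝ) ≤ P) (J : ℕ) :
    (1 + P ^ (-α) / 2) ^ S.card ≤ ∑ A ∈ S.powerset with A.card ≤ J,
        (1 / 2 : ℝ) ^ A.card * ((∏ p ∈ A, p : ℕ) : ℝ) ^ (-α)
      + Real.exp (Real.exp 1 * (S.card * (P ^ (-α) / 2)) - J) := by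
  refine (one_add_pow_card_le_sum_powerset (by positivity) J).trans ?_
  gcongr with A hA
  have hAS : A ⊆ S := Finset.mem_powerset.1 (Finset.mem_filter.1 hA).1
  have hprod : ((∏ p ∈ A, p : ℕ) : ℝ) ≤ P ^ A.card := by
    push_cast
    exact (Finset.prod_le_prod (fun _ _ => by positivity) fun p hp => hSP p (hAS hp)).trans_eq
      (Finset.prod_const P)
  have hpos : (0 : ℝ) < ((∏ p ∈ A, p : ℕ) : ℝ) := by
    exact_mod_cast Finset.prod_pos fun p hp => (hS p (hAS hp)).pos
  have h := Real.rpow_le_rpow_of_nonpos hpos hprod (by linarith : -α ≤ 0)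
  calc (P ^ (-α) / 2) ^ A.card = (1 / 2 : ℝ) ^ A.card * (P ^ A.card) ^ (-α) := by
        rw [div_eq_mul_one_div, mul_pow, mul_comm, ← Real.rpow_natCast (P ^ (-α)),
          ← Real.rpow_mul (by linarith), ← Real.rpow_natCast P, ← Real.rpow_mul (by linarith)]
        congr 2; ring
    _ ≤ _ := by gcongr

/-- Lower bound for a majorant `M` of `|ζ|` on `[α - iT, α + iT]` in terms of a set `S` of primes
at most `P`, a length `N` and a cut-off `J`. -/
theorem one_add_pow_le_of_norm_zeta_le {α T M P : ℝ} (h0 : 0 < α) (h1 : α < 1) (hT : 0 < T)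
    {N J : ℕ} (hN : 1 ≤ N) (hP : 1 ≤ P) {S : Finset ℕ} (hS : ∀ p ∈ S, p.Prime)
    (hSP : ∀ p ∈ S, (p : ℝ) ≤ P) (hJ : P ^ J ≤ N)
    (hM : ∀ t : ℝ, |t| ≤ T → ‖riemannZeta ((α : ℂ) + t * Complex.I)‖ ≤ M) :
    (1 + P ^ (-α) / 2) ^ S.card ≤ M + (1 + T) / α * (N : ℝ) ^ (-α)
      + (N : ℝ) ^ (1 - α) * (1 - α)⁻¹ * 4 ^ S.card * (2 * Real.arsinh T) / T
      + Real.exp (Real.exp 1 * (S.card * (P ^ (-α) / 2)) - J) := by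
  set F := reFourier T (fun t => (resonatorWeight T S t : ℂ)) 0 with hF
  have hFT : T ^ 2 ≤ F := by
    rw [← reFourier_triangle_zero hT.le]
    exact reFourier_triangle_le_resonatorWeight hT.le S 0
  have hF0 : 0 < F := lt_of_lt_of_le (by positivity) hFT
  have hres := resonance_inequality h0 h1 hT.le hN hS hM
    (𝒜 := S.powerset.filter fun A => A.card ≤ J) fun A hA => by
      obtain ⟨hA1, hA2⟩ := Finset.mem_filter.1 hA
      have hAS : A ⊆ S := Finset.mem_powerset.1 hA1
      refine ⟨hAS, ?_⟩
      have : ((∏ p ∈ A, p : ℕ) : ℝ) ≤ N := by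
        push_cast
        exact (Finset.prod_le_prod (fun _ _ => by positivity) fun p hp => hSP p (hAS hp)).trans
          ((Finset.prod_const P).trans_le ((pow_le_pow_right₀ hP hA2).trans hJ))
      exact_mod_cast this
  have hcomb := one_add_pow_card_le h0 hP hS hSP J
  set Z := ∑ A ∈ S.powerset with A.card ≤ J,
        (1 / 2 : ℝ) ^ A.card * ((∏ p ∈ A, p : ℕ) : ℝ) ^ (-α)
  set E := (N : ℝ) ^ (1 - α) * (1 - α)⁻¹ * 4 ^ S.card * (2 * Real.arsinh T) with hE
  have hE0 : 0 ≤ E := by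
    have : 0 ≤ Real.arsinh T := Real.arsinh_nonneg_iff.2 hT.le
    have : 0 < 1 - α := by linarith
    positivity
  have h2 : F * Z ≤ F * (M + (1 + T) / α * (N : ℝ) ^ (-α) + E / T) := by
    -- The bound `F ≥ T²`, from the triangle alone, makes the pole contribution relative to `F`.
    have : E * T ≤ F * (E / T) := by
      calc E * T = T ^ 2 * (E / T) := by field_simp
        _ ≤ F * (E / T) := by gcongr
    rw [← hF] at hres
    have e : (N : ℝ) ^ (1 - α) * (1 - α)⁻¹ * (T * 4 ^ S.card) * (2 * Real.arsinh T) = E * T := by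
      rw [hE]; ring
    rw [e] at hres
    linarith
  have h3 := le_of_mul_le_mul_left h2 hF0
  linarith

/-! ### Asymptotics of the parameters, with `L = log T`. -/

theorem tendsto_const_mul_mul_log {c : ℝ} (hc : 0 < c) :
    Tendsto (fun L : ℝ => c * (L * Real.log L)) atTop atTop :=
  (tendsto_id.atTop_mul_atTop₀ Real.tendsto_log_atTop).const_mul_atTop hc

theorem eventually_log_const_mul_mul_log_le {c : ℝ} (hc : 0 < c) (hc1 : c ≤ 1) :
    ∀ᶠ L : ℝ in atTop, Real.log (c * (L * Real.log L)) ≤ 1.1 * Real.log L := by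
  have h := (isLittleO_log_rpow_atTop (by norm_num : (0 : ℝ) < 0.1)).bound one_pos
  filter_upwards [h, eventually_ge_atTop 3] with L hL hL3
  have hlog : 0 < Real.log L := Real.log_pos (by linarith)
  have hL0 : 0 < L := by linarith
  rw [one_mul, Real.norm_of_nonneg hlog.le, Real.norm_of_nonneg (by positivity)] at hL
  calc Real.log (c * (L * Real.log L)) ≤ Real.log (L * L ^ (0.1 : ℝ)) := by
        refine Real.log_le_log (by positivity) ?_
        have : L * Real.log L ≤ L * L ^ (0.1 : ℝ) := by gcongr
        nlinarith [mul_pos hL0 hlog]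
    _ = 1.1 * Real.log L := by
        rw [Real.log_mul hL0.ne' (by positivity), Real.log_rpow hL0]; ring

theorem eventually_primeCounting_ge :
    ∀ᶠ x : ℝ in atTop, 0.6 * x ≤ (⌊x⌋₊.primeCounting : ℝ) * Real.log x := by
  have h := Real.isLittleO_log_id_atTop.bound (by norm_num : (0 : ℝ) < 0.01)
  have h' := (tendsto_atTop_add_const_right atTop (2 : ℝ) tendsto_id).eventually h
  filter_upwards [h', eventually_ge_atTop 100] with x hx hx1
  have hlog : 0 < Real.log x := Real.log_pos (by linarith)
  have hx2 : Real.log (x + 2) ≤ 0.01 * (x + 2) := by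
    have := le_trans (le_abs_self _) hx
    simpa [abs_of_nonneg (by linarith : 0 ≤ x + 2)] using this
  have hpi := Chebyshev.pi_ge' (x := x) (by linarith)
  rw [div_le_iff₀ hlog] at hpi
  nlinarith [Real.log_two_gt_d9]

/-- Chebyshev's `π(P) log P ≥ 0.6 P` and `log P ≤ 1.1 log L` give `π(P) ≥ (0.6/1.1) cL`, which
exceeds `cL/2`. -/
theorem eventually_exists_primes {c : ℝ} (hc : 0 < c) (hc1 : c ≤ 1) :
    ∀ᶠ L : ℝ in atTop, ∃ S : Finset ℕ, S.card = ⌊c * L / 2⌋₊ ∧ (∀ p ∈ S, p.Prime) ∧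
      ∀ p ∈ S, (p : ℝ) ≤ c * (L * Real.log L) := by
  filter_upwards [eventually_log_const_mul_mul_log_le hc hc1,
    (tendsto_const_mul_mul_log hc).eventually eventually_primeCounting_ge,
    (tendsto_const_mul_mul_log hc).eventually_ge_atTop 2, eventually_ge_atTop 3]
    with L hlog hpi hP hL
  set P := c * (L * Real.log L) with hPdef
  have hlogP : 0 < Real.log P := Real.log_pos (by linarith)
  have hcount : c * L / 2 ≤ (⌊P⌋₊.primeCounting : ℝ) := by
    refine le_of_mul_le_mul_right ?_ hlogP
    refine le_trans ?_ hpi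
    have hcL : 0 < c * L := by positivity
    calc c * L / 2 * Real.log P ≤ c * L / 2 * (1.1 * Real.log L) := by gcongr
      _ ≤ 0.6 * P := by
        rw [hPdef]
        have : 0 < Real.log L := Real.log_pos (by linarith)
        nlinarith [mul_pos hcL this]
  have hcard : ⌊c * L / 2⌋₊ ≤ (Nat.primesLE ⌊P⌋₊).card := by
    rw [Nat.primesLE_card_eq_primeCounting]
    exact Nat.floor_le_of_le hcount
  obtain ⟨S, hSsub, hScard⟩ := Finset.exists_subset_card_eq hcard
  refine ⟨S, hScard, fun p hp => (Nat.mem_primesLE.1 (hSsub hp)).2, fun p hp => ?_⟩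
  exact (Nat.le_floor_iff (by linarith)).1 (Nat.mem_primesLE.1 (hSsub hp)).1

/-- This fixes `c = 2α - 1`. With `N ≈ T^{1/α}` the powers of `T` contribute `(1-α)/α - 1 ≤
-(2α-1)`, while `4^{cL/2} = T^{c log 2}`; the net exponent is at most `-(2α-1)(1 - log 2) < 0`,
which beats the factor `log T`. -/
theorem eventually_pole_term_le {α : ℝ} (h0 : 1 / 2 < α) (h1 : α < 1) :
    ∀ᶠ L : ℝ in atTop, ∀ N : ℕ, (N : ℝ) ≤ 2 * Real.exp L ^ (1 / α) →
      (N : ℝ) ^ (1 - α) * (1 - α)⁻¹ * 4 ^ ⌊(2 * α - 1) * L / 2⌋₊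
        * (2 * Real.arsinh (Real.exp L)) / Real.exp L ≤ 1 := by
  have hc : 0 < 2 * α - 1 := by linarith
  have h1' : 0 < 1 - α := by linarith
  set b := (2 * α - 1) * (1 - Real.log 2) with hb
  have hb0 : 0 < b := mul_pos hc (by linarith [Real.log_two_lt_d9])
  have hlim : Tendsto (fun L : ℝ => 4 * (1 - α)⁻¹ * (L * Real.exp (-b * L)
      + 2 * Real.exp (-b * L))) atTop (𝓝 (4 * (1 - α)⁻¹ * (0 + 2 * 0))) := by
    refine Tendsto.const_mul _ (Tendsto.add ?_ (Tendsto.const_mul _ ?_))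
    · simpa using tendsto_rpow_mul_exp_neg_mul_atTop_nhds_zero 1 b hb0
    · simpa using tendsto_rpow_mul_exp_neg_mul_atTop_nhds_zero 0 b hb0
  have hev := hlim.eventually_le_const (u := 1) (by simp)
  filter_upwards [hev, eventually_ge_atTop 1] with L hL hL1 N hN
  refine le_trans ?_ hL
  have hT1 : 1 ≤ Real.exp L := Real.one_le_exp (by linarith)
  have hars : Real.arsinh (Real.exp L) ≤ L + 2 := by
    rw [Real.arsinh]
    have hsq : √(1 + Real.exp L ^ 2) ≤ 2 * Real.exp L :=
      Real.sqrt_le_iff.2 ⟨by positivity, by nlinarith⟩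
    have h3 : Real.exp L + √(1 + Real.exp L ^ 2) ≤ Real.exp (L + 2) := by
      rw [Real.exp_add]
      have : (3 : ℝ) ≤ Real.exp 2 := by linarith [Real.add_one_le_exp (2 : ℝ)]
      nlinarith [Real.exp_pos L]
    calc _ ≤ Real.log (Real.exp (L + 2)) := Real.log_le_log (by positivity) h3
      _ = _ := Real.log_exp _
  have hN' : (N : ℝ) ^ (1 - α) ≤ 2 * Real.exp (L * ((1 - α) / α)) := by
    calc (N : ℝ) ^ (1 - α) ≤ (2 * Real.exp L ^ (1 / α)) ^ (1 - α) :=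
          Real.rpow_le_rpow (by positivity) hN h1'.le
      _ = 2 ^ (1 - α) * Real.exp (L * ((1 - α) / α)) := by
          rw [Real.mul_rpow (by norm_num) (by positivity), ← Real.exp_mul, ← Real.exp_mul]
          congr 2; ring
      _ ≤ 2 ^ (1 : ℝ) * Real.exp (L * ((1 - α) / α)) := by
          gcongr
          · norm_num
          · linarith
      _ = _ := by rw [Real.rpow_one]
  have h4 : (4 : ℝ) ^ ⌊(2 * α - 1) * L / 2⌋₊ ≤ Real.exp ((2 * α - 1) * L * Real.log 2) := by
    have hfl := Nat.floor_le (by positivity : 0 ≤ (2 * α - 1) * L / 2)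
    have e4 : (4 : ℝ) = Real.exp (2 * Real.log 2) := by
      rw [two_mul, Real.exp_add, Real.exp_log (by norm_num)]; norm_num
    rw [e4, ← Real.exp_nat_mul]
    refine Real.exp_le_exp.2 ?_
    nlinarith [Real.log_pos (by norm_num : (1 : ℝ) < 2)]
  have hexp : L * ((1 - α) / α) + (2 * α - 1) * L * Real.log 2 - L ≤ -b * L := by
    have : (1 - α) / α - 1 ≤ -(2 * α - 1) := by
      rw [div_sub_one (by linarith), div_le_iff₀ (by linarith)]
      nlinarith
    rw [hb]
    nlinarith
  calc _ ≤ 2 * Real.exp (L * ((1 - α) / α)) * (1 - α)⁻¹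
        * Real.exp ((2 * α - 1) * L * Real.log 2) * (2 * (L + 2)) / Real.exp L := by
        have : 0 ≤ Real.arsinh (Real.exp L) := Real.arsinh_nonneg_iff.2 (by positivity)
        gcongr
    _ = 4 * (1 - α)⁻¹ * (L + 2)
        * Real.exp (L * ((1 - α) / α) + (2 * α - 1) * L * Real.log 2 - L) := by
        rw [Real.exp_sub, Real.exp_add]; ring
    _ ≤ 4 * (1 - α)⁻¹ * (L + 2) * Real.exp (-b * L) := by gcongr
    _ = _ := by ring

/-- This makes the exponent in the Rankin tail nonpositive. The left side is at most `L P^{-α}`,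
which is smaller than `L / log P` because `P^{-α} log P` tends to zero. -/
theorem eventually_cutoff {α c : ℝ} (h0 : 0 < α) (hc : 0 < c) (hc1 : c ≤ 1) :
    ∀ᶠ L : ℝ in atTop, Real.exp 1 *
        (⌊c * L / 2⌋₊ * ((c * (L * Real.log L)) ^ (-α) / 2))
      ≤ (⌊L / Real.log (c * (L * Real.log L))⌋₊ : ℝ) := by
  have hlogP : ∀ᶠ x : ℝ in atTop, x ^ (-α) * Real.log x ≤ 1 / 2 := by
    filter_upwards [(isLittleO_log_rpow_atTop h0).bound (by norm_num : (0 : ℝ) < 1 / 2),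
      eventually_gt_atTop 1] with x hx hx1
    have hx0 : 0 < x := by linarith
    rw [Real.norm_of_nonneg (Real.log_nonneg hx1.le), Real.norm_of_nonneg (by positivity)] at hx
    rw [Real.rpow_neg hx0.le, inv_mul_le_iff₀ (by positivity)]
    linarith
  have hlogL := Real.isLittleO_log_id_atTop.bound (by norm_num : (0 : ℝ) < 0.4)
  filter_upwards [eventually_log_const_mul_mul_log_le hc hc1,
    (tendsto_const_mul_mul_log hc).eventually hlogP, hlogL,
    (tendsto_const_mul_mul_log hc).eventually_ge_atTop 2, eventually_ge_atTop 3]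
    with L hlog hx hL hP hL3
  set P := c * (L * Real.log L)
  have hL0 : 0 < L := by linarith
  have hP0 : 0 < P := by linarith
  have hlP : 0 < Real.log P := Real.log_pos (by linarith)
  rw [Real.norm_of_nonneg (Real.log_nonneg (by linarith)), id, Real.norm_of_nonneg hL0.le] at hL
  have hfl := Nat.floor_le (by positivity : 0 ≤ c * L / 2)
  have hJ := Nat.lt_floor_add_one (L / Real.log P)
  have hx0 : 0 < P ^ (-α) := by positivity
  have hK : Real.exp 1 * (⌊c * L / 2⌋₊ * (P ^ (-α) / 2)) ≤ L * P ^ (-α) := by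
    calc Real.exp 1 * (⌊c * L / 2⌋₊ * (P ^ (-α) / 2))
        ≤ 4 * (c * L / 2 * (P ^ (-α) / 2)) := by
          gcongr
          linarith [Real.exp_one_lt_d9]
      _ = c * (L * P ^ (-α)) := by ring
      _ ≤ 1 * (L * P ^ (-α)) := by gcongr
      _ = _ := one_mul _
  have hmain : L * P ^ (-α) + 1 ≤ L / Real.log P := by
    rw [le_div_iff₀ hlP]
    nlinarith
  linarith

theorem const_mul_mul_rpow_eq {α c L : ℝ} (hc : 0 < c) (hL : 1 < L) :
    c * L * (c * (L * Real.log L)) ^ (-α) = c ^ (1 - α) * L ^ (1 - α) / Real.log L ^ α := by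
  have hL0 : 0 < L := by linarith
  have hlog : 0 < Real.log L := Real.log_pos hL
  rw [Real.mul_rpow hc.le (by positivity), Real.mul_rpow hL0.le hlog.le, Real.rpow_neg hlog.le,
    sub_eq_add_neg, Real.rpow_add hc, Real.rpow_add hL0, Real.rpow_one, Real.rpow_one]
  ring

/-- With `Z = cL P^{-α}`, the logarithm of the right side is close to `Z/4`. The floor costs a
factor `0.95` and `log (1 + y) ≥ 0.9 y` another, leaving `0.21375 Z`; the gap above `0.18 Z` absorbs
the additive `6`, which is the total `4 + 1 + 1` of the error terms. -/
theorem eventually_exp_le_one_add_pow {α c : ℝ} (h0 : 0 < α) (h1 : α < 1) (hc : 0 < c) :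
    ∀ᶠ L : ℝ in atTop, Real.exp (0.18 * c ^ (1 - α) * L ^ (1 - α) / Real.log L ^ α) + 6
      ≤ (1 + (c * (L * Real.log L)) ^ (-α) / 2) ^ ⌊c * L / 2⌋₊ := by
  have hZ : Tendsto (fun L : ℝ => c ^ (1 - α) * L ^ (1 - α) / Real.log L ^ α) atTop atTop := by
    have hlo := isLittleO_log_rpow_rpow_atTop α (by linarith : 0 < 1 - α)
    have hinv : Tendsto (fun L : ℝ => Real.log L ^ α / L ^ (1 - α)) atTop (𝓝[>] 0) := by
      refine tendsto_nhdsWithin_iff.2 ⟨hlo.tendsto_div_nhds_zero, ?_⟩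
      filter_upwards [eventually_gt_atTop 1] with L hL
      have : 0 < Real.log L := Real.log_pos hL
      have : 0 < L := by linarith
      exact Set.mem_Ioi.2 (by positivity)
    refine (hinv.inv_tendsto_nhdsGT_zero.const_mul_atTop
      (by positivity : 0 < c ^ (1 - α))).congr fun L => ?_
    simp only [Pi.inv_apply, inv_div]
    ring
  have hx0 : ∀ᶠ x : ℝ in atTop, x ^ (-α) ≤ 0.1 :=
    (tendsto_rpow_neg_atTop h0).eventually_le_const (by norm_num)
  filter_upwards [hZ.eventually_ge_atTop 200, (tendsto_const_mul_mul_log hc).eventually hx0,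
    (tendsto_const_mul_mul_log hc).eventually_gt_atTop 0,
    eventually_ge_atTop (40 / c), eventually_gt_atTop 1] with L hZL hx hP hcL hL1
  have hZe := const_mul_mul_rpow_eq (α := α) hc hL1
  set P := c * (L * Real.log L)
  set K := ⌊c * L / 2⌋₊
  set x := P ^ (-α) with hxdef
  have hxpos : 0 < x := by positivity
  rw [div_le_iff₀' hc] at hcL
  have e1 : 0.18 * c ^ (1 - α) * L ^ (1 - α) / Real.log L ^ α = 0.18 * (c * L * x) := by
    rw [hZe]; ring
  rw [← hZe] at hZL
  rw [e1]
  set Z := c * L * x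
  have hK : 0.95 * (c * L / 2) ≤ K := by
    have := Nat.lt_floor_add_one (c * L / 2)
    linarith
  have hlog : 0.9 * (x / 2) ≤ Real.log (1 + x / 2) := by
    have h := Real.one_sub_inv_le_log_of_pos (by positivity : 0 < 1 + x / 2)
    refine le_trans ?_ h
    have e : 1 - (1 + x / 2)⁻¹ = (x / 2) / (1 + x / 2) := by field_simp; ring
    rw [e, le_div_iff₀ (by positivity)]
    nlinarith
  have hpow : Real.exp (0.2 * Z) ≤ (1 + x / 2) ^ K := by
    rw [← Real.exp_log (by positivity : 0 < (1 + x / 2) ^ K), Real.log_pow]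
    refine Real.exp_le_exp.2 ?_
    calc 0.2 * Z ≤ 0.95 * (c * L / 2) * (0.9 * (x / 2)) := by
          have : 0 < Z := by linarith
          have e : 0.95 * (c * L / 2) * (0.9 * (x / 2)) = 0.21375 * Z := by ring
          rw [e]; linarith
      _ ≤ K * Real.log (1 + x / 2) := by gcongr
  refine le_trans ?_ hpow
  have e2 : Real.exp (0.2 * Z) = Real.exp (0.18 * Z) * Real.exp (0.02 * Z) := by
    rw [← Real.exp_add]; congr 1; ring
  have h3 : 5 ≤ Real.exp (0.02 * Z) := by linarith [Real.add_one_le_exp (0.02 * Z)]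
  have h4 : 37 ≤ Real.exp (0.18 * Z) := by linarith [Real.add_one_le_exp (0.18 * Z)]
  rw [e2]
  nlinarith

/-! ### Choice of parameters and conclusion. -/

theorem theorem1 (α : ℝ) (hα : α ∈ Set.Ioo (1 / 2 : ℝ) 1) :
    ∃ T₀ : ℝ, ∀ T : ℝ, T₀ ≤ T →
      ∃ m : ℝ,
        IsGreatest
          ((fun t : ℝ => ‖riemannZeta ((α : ℂ) + (t : ℂ) * Complex.I)‖) '' Set.Icc (0 : ℝ) T) m ∧
        Real.exp ((0.18 * (2 * α - 1) ^ (1 - α)) * (Real.log T) ^ (1 - α) /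
          (Real.log (Real.log T)) ^ α) ≤ m := by
  obtain ⟨h12, h1⟩ := hα
  have h0 : 0 < α := by linarith
  have hc : 0 < 2 * α - 1 := by linarith
  have hc1 : 2 * α - 1 ≤ 1 := by linarith
  rw [← eventually_atTop]
  filter_upwards [Real.tendsto_log_atTop.eventually (eventually_exists_primes hc hc1),
    Real.tendsto_log_atTop.eventually (eventually_pole_term_le h12 h1),
    Real.tendsto_log_atTop.eventually (eventually_cutoff h0 hc hc1),
    Real.tendsto_log_atTop.eventually (eventually_exp_le_one_add_pow h0 h1 hc),
    (tendsto_const_mul_mul_log hc |>.comp Real.tendsto_log_atTop).eventually_ge_atTop 2,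
    eventually_ge_atTop 3] with T hprimes hpole hcut hmain hP hT
  obtain ⟨S, hScard, hS, hSP⟩ := hprimes
  have hT0 : 0 < T := by linarith
  rw [Function.comp_apply] at hP
  rw [Real.exp_log hT0] at hpole
  have hlogT : 0 ≤ Real.log T := Real.log_nonneg (by linarith)
  set P := (2 * α - 1) * (Real.log T * Real.log (Real.log T)) with hPdef
  have hlogP : 0 < Real.log P := Real.log_pos (by linarith)
  set J := ⌊Real.log T / Real.log P⌋₊ with hJ
  have hT1 : 1 ≤ T ^ (1 / α) := Real.one_le_rpow (by linarith) (by positivity)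
  -- This length gives `N^{-α} ≤ 1/T`, so the approximation error `(1+T) N^{-α}/α` stays bounded for
  -- `|t| ≤ T`.
  set N := ⌈T ^ (1 / α)⌉₊ with hN
  have hNle : T ^ (1 / α) ≤ N := Nat.le_ceil _
  have hNlt : (N : ℝ) ≤ 2 * T ^ (1 / α) := by
    linarith [Nat.ceil_lt_add_one (by linarith : 0 ≤ T ^ (1 / α))]
  have hTN : T ≤ N := by
    refine le_trans ?_ hNle
    conv_lhs => rw [← Real.rpow_one T]
    exact Real.rpow_le_rpow_of_exponent_le (by linarith) (by rw [le_div_iff₀ h0]; linarith)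
  have hJN : P ^ J ≤ N := by
    refine le_trans ?_ hTN
    rw [← Real.log_le_log_iff (by positivity) hT0, Real.log_pow]
    exact (le_div_iff₀ hlogP).1 (Nat.floor_le (by positivity))
  have hcont : ContinuousOn
      (fun t : ℝ => ‖riemannZeta ((α : ℂ) + (t : ℂ) * Complex.I)‖) (Set.Icc 0 T) := by
    refine Continuous.continuousOn (continuous_iff_continuousAt.2 fun t => ?_)
    have hne : (α : ℂ) + (t : ℂ) * Complex.I ≠ 1 := fun h => by
      have := congrArg Complex.re h
      simp at this
      linarith
    exact ((differentiableAt_riemannZeta hne).continuousAt.comp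
      (f := fun t : ℝ => (α : ℂ) + (t : ℂ) * Complex.I)
      (by fun_prop : Continuous _).continuousAt).norm
  obtain ⟨m, hm⟩ := (isCompact_Icc.image_of_continuousOn hcont).exists_isGreatest
    ((Set.nonempty_Icc.2 hT0.le).image _)
  refine ⟨m, hm, ?_⟩
  -- The maximum over `[0, T]` also controls `[-T, 0]`, since `ζ` commutes with conjugation.
  have hM : ∀ t : ℝ, |t| ≤ T → ‖riemannZeta ((α : ℂ) + t * Complex.I)‖ ≤ m := by
    intro t ht
    have habs := hm.2 ⟨|t|, ⟨abs_nonneg t, ht⟩, rfl⟩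
    simp only at habs
    rcases abs_choice t with h | h
    · rwa [h] at habs
    · rw [h] at habs
      have e : (α : ℂ) + ((-t : ℝ) : ℂ) * Complex.I
          = (starRingEnd ℂ) ((α : ℂ) + t * Complex.I) := by simp
      rwa [e, riemannZeta_conj, RCLike.norm_conj] at habs
  have hN1 : 1 ≤ N := by
    have : (1 : ℝ) ≤ N := by linarith
    exact_mod_cast this
  have key := one_add_pow_le_of_norm_zeta_le h0 h1 hT0 hN1 (by linarith : 1 ≤ P) hS hSP hJN hM
  rw [hScard] at key
  have herr : (1 + T) / α * (N : ℝ) ^ (-α) ≤ 4 := by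
    have hNα : (N : ℝ) ^ (-α) ≤ T⁻¹ := by
      calc (N : ℝ) ^ (-α) ≤ (T ^ (1 / α)) ^ (-α) :=
            Real.rpow_le_rpow_of_nonpos (by positivity) hNle (by linarith)
        _ = T⁻¹ := by
            rw [← Real.rpow_mul hT0.le, ← Real.rpow_neg_one]; congr 1; field_simp
    calc (1 + T) / α * (N : ℝ) ^ (-α) ≤ (1 + T) / α * T⁻¹ := by gcongr
      _ = (1 + T) / (α * T) := by field_simp
      _ ≤ 4 := by rw [div_le_iff₀ (by positivity)]; nlinarith
  have hexp : Real.exp (Real.exp 1 *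
      ((⌊(2 * α - 1) * Real.log T / 2⌋₊ : ℝ) * (P ^ (-α) / 2)) - J) ≤ 1 :=
    Real.exp_le_one_iff.2 (by linarith)
  linarith [hpole N hNlt]
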